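/- Let $G$ be the graph with vertex set $V=\{1,2,3,4\}$ and edges $1-2$, $2-3$, $2-4$, $3-4$. In the matching model on $G$, items arrive one at a time, their classes $v_0,v_1,\dots$ being i.i.d. with law $\mu$, where $\mu(i)>0$ for all $i\in V$. The buffer is initially empty; its content is a word over $V$ (items in order of arrival) in which no two adjacent classes both occur. If the buffer holds no item whose class is adjacent to that of the arriving item, the arriving item is appended to the buffer; otherwise it is not stored and exactly one item of an adjacent class is removed from the buffer. Which item is removed is decided by the matching policy $\Phi$ as a function of the current buffer content and of the arriving class. So the buffer content is a Markov chain; $\mu$ is called stable for $\Phi$ if this chain is positive recurrent. Let $\mathrm{Stab}(\Phi)$ be the set of all $\mu$ that are stable for $\Phi$ and satisfy $\mu(3)=\mu(4)$. In a priority policy, each class $i$ has a fixed total order of preference on its neighbours, and an arriving item of class $i$ is matched with an item of the most preferred neighbouring class present in the buffer. Let $A$ be a priority policy in which class $2$ prefers both $3$ and $4$ to $1$, and let $B$ be a priority policy in which class $2$ prefers $1$ to both $3$ and $4$. Then, among the probability measures $\mu$ on $V$ with all $\mu(i)>0$ and $\mu(3)=\mu(4)$, $$\mathrm{Stab}(A)=\{\mu(1)<\mu(2)<1/2\}\cap\{\mu(1)(1-\mu(1))<\mu(2)^2\},\qquad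 \mathrm{Stab}(B)=\{\mu(1)<\mu(2)<1/2\}.$$ Moreover, for every matching policy $\Phi$ on $G$, $\mathrm{Stab}(A)\subseteq\mathrm{Stab}(\Phi)\subseteq\mathrm{Stab}(B)$: policy $A$ has the smallest possible stability region and policy $B$ the largest possible one. -/

import Mathlib

open scoped ENNReal

namespace MatchingModel

/-! ### Positive recurrence of Markov chains -/

section MarkovChain

variable {S : Type*}

open Classical in
/-- `firstPassage P y n x` is the probability that the Markov chain with transition matrix `P`
started at `x` visits `y` for the first time after time `0` exactly at time `n`. -/
noncomputable def firstPassage (P : S → S → ℝ≥0∞) (y : S) : ℕ → S → ℝ≥0∞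
  | 0, _ => 0
  | 1, x => P x y
  | n + 2, x => ∑' z : S, if z = y then 0 else P x z * firstPassage P y (n + 1) z

/-- A chain is positive recurrent if from each state it returns to that state almost surely, and
the expected return time is finite. -/
def PositiveRecurrent (P : S → S → ℝ≥0∞) : Prop :=
  ∀ x : S, ∑' n : ℕ, firstPassage P x n x = 1 ∧
    ∑' n : ℕ, (n : ℝ≥0∞) * firstPassage P x n x < ∞

end MarkovChain

/-! ### Matching models -/

section Model

variable {V : Type*} [DecidableEq V]

/-- Buffer contents: words (oldest item first) in which no two adjacent classes both occur. -/
def Buffer (G : SimpleGraph V) : Type _ :=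
  {u : List V // ∀ i j : V, G.Adj i j → u.count i * u.count j = 0}

/-- A matching policy gives the new buffer content after an arrival of class `v` in a buffer of
content `u`: if no item of the buffer is compatible with `v`, then the arriving item is added at
the end of the buffer; otherwise it is not added and exactly one compatible item is removed, which
one being decided by the policy as a function of `u` and `v`. -/
structure MatchingPolicy (G : SimpleGraph V) where
  step : Buffer G → V → Buffer G
  step_of_unmatched : ∀ (u : Buffer G) (v : V), (∀ j ∈ u.1, ¬ G.Adj v j) →
    (step u v).1 = u.1 ++ [v]
  step_of_matched : ∀ (u : Buffer G) (v : V), (∃ j ∈ u.1, G.Adj v j) →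
    ∃ (x : List V) (j : V) (y : List V),
      G.Adj v j ∧ u.1 = x ++ j :: y ∧ (step u v).1 = x ++ y

/-- The set of probability measures on `V` (given by their weights) charging every point. -/
def posProb (V : Type*) [Fintype V] : Set (V → ℝ) :=
  {μ | (∀ v, 0 < μ v) ∧ ∑ v, μ v = 1}

/-- The transition matrix of the chain `U (n + 1) = Φ (U n) (v n)`, with `v n` i.i.d. of law
`μ`. -/
noncomputable def MatchingPolicy.transition [Fintype V] {G : SimpleGraph V}
    (Φ : MatchingPolicy G) (μ : V → ℝ) (u w : Buffer G) : ℝ≥0∞ :=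
  open Classical in ∑ v : V, if Φ.step u v = w then ENNReal.ofReal (μ v) else 0

/-- The stability region of a policy: the `μ` for which the buffer content is a positive recurrent
Markov chain. -/
def MatchingPolicy.stabilityRegion [Fintype V] {G : SimpleGraph V} (Φ : MatchingPolicy G) :
    Set (V → ℝ) :=
  {μ | μ ∈ posProb V ∧ PositiveRecurrent (Φ.transition μ)}

/-! ### Priority policies -/

/-- The commutative image of a buffer content: the number of items of each class. -/
def Buffer.counts {G : SimpleGraph V} (u : Buffer G) : V → ℕ := fun i => u.1.count i

/-- For each class `i`, a total order on the set of its neighbours (larger means preferred). -/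
abbrev Preferences (G : SimpleGraph V) : Type _ := ∀ i : V, LinearOrder (G.neighborSet i)

/-- Class `i` gives priority to its neighbour `j` over its neighbour `k`. -/
def Prefers {G : SimpleGraph V} (pref : Preferences G) (i j k : V) : Prop :=
  ∃ (hj : j ∈ G.neighborSet i) (hk : k ∈ G.neighborSet i),
    (pref i).lt ⟨k, hk⟩ ⟨j, hj⟩

/-- `j` is the most preferred neighbour of `i` among those present in `c`. -/
def IsPreferred {G : SimpleGraph V} (pref : Preferences G) (c : V → ℕ) (i : V)
    (j : G.neighborSet i) : Prop :=
  @IsGreatest (G.neighborSet i) (pref i).toLE {k | 0 < c k} j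

/-- `Φ` is the priority policy with the given preferences: an arriving item of class `i` is stored
if no class compatible with `i` is present, and otherwise it is matched with an item of the
most preferred class among the compatible classes present in the buffer. -/
def MatchingPolicy.IsPriority {G : SimpleGraph V} (Φ : MatchingPolicy G)
    (pref : Preferences G) : Prop :=
  ∀ (u : Buffer G) (i : V),
    ((∀ j ∈ G.neighborSet i, u.counts j = 0) →
      (Φ.step u i).counts = u.counts + Pi.single i 1) ∧
    (∀ j : G.neighborSet i, IsPreferred pref u.counts i j →
      (Φ.step u i).counts = u.counts - Pi.single (j : V) 1)

/-- Every family of preferences is that of some priority policy. -/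
theorem exists_isPriority [Finite V] {G : SimpleGraph V} (pref : Preferences G) :
    ∃ Φ : MatchingPolicy G, Φ.IsPriority pref := by
  classical
  have key : ∀ (u : Buffer G) (v : V), ∃ w : Buffer G,
      ((∀ j ∈ u.1, ¬ G.Adj v j) → w.1 = u.1 ++ [v]) ∧
      ((∃ j ∈ u.1, G.Adj v j) → ∃ j : G.neighborSet v, IsPreferred pref u.counts v j ∧
        w.1 = u.1.erase j) := by
    intro u v
    by_cases h : ∃ j ∈ u.1, G.Adj v j
    · obtain ⟨j₀, hj₀, hadj⟩ := h
      obtain ⟨j, hj⟩ : ∃ j, IsPreferred pref u.counts v j := by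
        let := pref v
        have hfin : ({k : G.neighborSet v | 0 < u.counts k}).Finite := Set.toFinite _
        obtain ⟨j, hj, hmax⟩ := Set.exists_max_image _ id hfin
          ⟨⟨j₀, hadj⟩, List.count_pos_iff.2 hj₀⟩
        exact ⟨j, hj, fun k hk => hmax k hk⟩
      refine ⟨⟨u.1.erase j, fun a b hab => ?_⟩,
        fun h => absurd hadj (h j₀ hj₀), fun _ => ⟨j, hj, rfl⟩⟩
      have h1 := u.2 a b hab
      have ha : (u.1.erase j).count a ≤ u.1.count a := List.erase_sublist.count_le a
      have hb : (u.1.erase j).count b ≤ u.1.count b := List.erase_sublist.count_le b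
      exact Nat.eq_zero_of_le_zero ((Nat.mul_le_mul ha hb).trans h1.le)
    · have h' : ∀ j ∈ u.1, ¬ G.Adj v j := fun j hj hv => h ⟨j, hj, hv⟩
      refine ⟨⟨u.1 ++ [v], fun a b hab => ?_⟩, fun _ => rfl, fun hh => absurd hh h⟩
      have h1 := u.2 a b hab
      have hne := hab.ne
      have hz : ∀ k, G.Adj v k → u.1.count k = 0 := fun k hk =>
        List.count_eq_zero.2 fun hm => h' k hm hk
      by_cases hav : v = a
      · subst hav
        simp [List.count_append, hz b hab, hne]
      · by_cases hbv : v = b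
        · subst hbv
          simp [List.count_append, hz a hab.symm, hne.symm]
        · simpa [List.count_append, hav, hbv] using h1
  choose f hf1 hf2 using key
  refine ⟨⟨f, hf1, fun u v h => ?_⟩, fun u i => ⟨fun h => ?_, fun j hj => ?_⟩⟩
  · obtain ⟨j, hj, hw⟩ := hf2 u v h
    obtain ⟨x, y, -, hxy, he⟩ := List.exists_erase_eq (List.count_pos_iff.1 hj.1)
    exact ⟨x, j, y, j.2, hxy, hw.trans he⟩
  · funext a
    have := hf1 u i fun j hj hadj => List.count_eq_zero.1 (h j hadj) hj
    by_cases hia : i = a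
    · subst hia
      simp [Buffer.counts, this, List.count_append]
    · simp [Buffer.counts, this, List.count_append, hia, Ne.symm hia]
  · obtain ⟨k, hk, hw⟩ := hf2 u i ⟨j, List.count_pos_iff.1 hj.1, j.2⟩
    let := pref i
    have hjk : k = j := IsGreatest.unique hk hj
    subst hjk
    funext a
    by_cases hka : (k : V) = a
    · subst hka
      simp [Buffer.counts, hw]
    · simp [Buffer.counts, hw, List.count_erase_of_ne (Ne.symm hka), Ne.symm hka]

end Model

/-! ### The graph with edges 1 - 2, 2 - 3, 2 - 4, 3 - 4 -/

/-- The four item classes. -/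
inductive Cls : Type
  | c1 | c2 | c3 | c4
  deriving DecidableEq

instance : Fintype Cls := ⟨{.c1, .c2, .c3, .c4}, by intro x; cases x <;> decide⟩

/-- The matching graph with edges `1 - 2`, `2 - 3`, `2 - 4`, `3 - 4`. -/
def graph : SimpleGraph Cls :=
  SimpleGraph.fromEdgeSet {s(.c1, .c2), s(.c2, .c3), s(.c2, .c4), s(.c3, .c4)}

/-- Policy A: a priority policy in which 2 gives priority to "3 or 4" over 1. -/
def IsPolicyA (Φ : MatchingPolicy graph) : Prop :=
  ∃ pref : Preferences graph, Φ.IsPriority pref ∧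
    Prefers pref .c2 .c3 .c1 ∧ Prefers pref .c2 .c4 .c1

/-- Policy B: a priority policy in which 2 gives priority to 1 over "3 or 4". -/
def IsPolicyB (Φ : MatchingPolicy graph) : Prop :=
  ∃ pref : Preferences graph, Φ.IsPriority pref ∧
    Prefers pref .c2 .c1 .c3 ∧ Prefers pref .c2 .c1 .c4

/-- The part of the stability region of `Φ` in which `μ(3) = μ(4)`. -/
def Stab (Φ : MatchingPolicy graph) : Set (Cls → ℝ) :=
  Φ.stabilityRegion ∩ {μ | μ .c3 = μ .c4}

end MatchingModel

/-! Write x, n, y for the numbers of items of class 1, of class 2, and of classes 3 and 4 together,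
and a, b, c for μ(1), μ(2), μ(3) = μ(4). Classes 3 and 4 are never both present, so for y > 0 their
arrivals move y by +1 or -1 with equal probability c. The mean one-step change of a function of (x,
n, y) thus depends on the policy only through what class 2 takes when x, y > 0 (`mean_step_cases`).
Each region then follows from a drift function.

Any stable policy needs b < 1/2, since n is otherwise a submartingale, and a < b, since x - n is
otherwise one. Under A, y evolves on its own while n = 0 and vanishes for a fraction b/(1 - a) of
the time; only then can class 2 reduce x, so x drifts by a - b²/(1 - a). The weight α = b/(1 - a)
turns this averaging into a one-step statement: x + αy has that same drift for y = 0 and y > 0 as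
long as class 2 finds a match and prefers 3 and 4. Matching class 2 with class 1 instead gives a -
b. Hence the condition on A is necessary for A (`lt_sq_of_policyA_stable`) and sufficient for every
policy (`stable_of_lt_sq`). Under B, x has drift a - b whenever it is positive, and a quadratic
function proves stability (`stable_of_policyB`). The inclusions result because the conditions for B
are necessary for all policies and those for A are sufficient for all.

The two drift criteria, `not_positiveRecurrent_of_drift` and `positiveRecurrent_of_drift`, are
proved from the tails P(τ > n) of return times. -/

namespace MatchingModel

/-! ### Chains driven by i.i.d. inputs -/

section Driven

open Filter Topology

variable {S V : Type*} [Fintype V]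

open Classical in
/-- The transition matrix of the chain `X (n + 1) = T (X n) (v n)`, with `v n` i.i.d. of law `μ`. -/
noncomputable def drivenKernel (T : S → V → S) (μ : V → ℝ) (x w : S) : ℝ≥0∞ :=
  ∑ v : V, if T x v = w then ENNReal.ofReal (μ v) else 0

open Classical in
/-- The probability that the driven chain started at `x` does not visit `z` at times `1, …, n`. -/
noncomputable def survival (T : S → V → S) (μ : V → ℝ) (z : S) : ℕ → S → ℝ
  | 0, _ => 1
  | n + 1, x => ∑ v : V, if T x v = z then 0 else μ v * survival T μ z n (T x v)

variable {T : S → V → S} {μ : V → ℝ}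

theorem survival_nonneg (hμ : ∀ v, 0 ≤ μ v) (z : S) (n : ℕ) (x : S) :
    0 ≤ survival T μ z n x := by
  induction n generalizing x with
  | zero => exact zero_le_one
  | succ n ih =>
    refine Finset.sum_nonneg fun v _ => ?_
    split_ifs
    exacts [le_rfl, mul_nonneg (hμ v) (ih _)]

theorem survival_succ_le (hμ : ∀ v, 0 ≤ μ v) (hsum : ∑ v, μ v = 1) (z : S) (n : ℕ) (x : S) :
    survival T μ z (n + 1) x ≤ survival T μ z n x := by
  induction n generalizing x with
  | zero =>
    simp only [survival, mul_one]
    refine (Finset.sum_le_sum fun v _ => ?_).trans hsum.le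
    split_ifs
    exacts [hμ v, le_rfl]
  | succ n ih =>
    rw [survival, survival]
    refine Finset.sum_le_sum fun v _ => ?_
    split_ifs
    exacts [le_rfl, mul_le_mul_of_nonneg_left (ih _) (hμ v)]

theorem survival_antitone (hμ : ∀ v, 0 ≤ μ v) (hsum : ∑ v, μ v = 1) (z x : S) :
    Antitone fun n => survival T μ z n x :=
  antitone_nat_of_succ_le fun n => survival_succ_le hμ hsum z n x

theorem survival_le_one (hμ : ∀ v, 0 ≤ μ v) (hsum : ∑ v, μ v = 1) (z : S) (n : ℕ) (x : S) :
    survival T μ z n x ≤ 1 :=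
  survival_antitone hμ hsum z x n.zero_le

open Classical in
theorem tsum_drivenKernel (z x : S) (F : S → ℝ≥0∞) :
    ∑' w, (if w = z then 0 else drivenKernel T μ x w * F w) =
      ∑ v, if T x v = z then 0 else ENNReal.ofReal (μ v) * F (T x v) := by
  have h : ∀ w, (if w = z then 0 else drivenKernel T μ x w * F w) =
      ∑ v, if w = T x v then (if T x v = z then 0 else ENNReal.ofReal (μ v) * F (T x v))
        else 0 := by
    intro w
    split_ifs with hw
    · refine (Finset.sum_eq_zero fun v _ => ?_).symm
      split_ifs with h1 h2 <;> simp_all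
    · rw [drivenKernel, Finset.sum_mul]
      refine Finset.sum_congr rfl fun v _ => ?_
      by_cases h1 : w = T x v
      · subst h1; simp [hw]
      · simp [h1, Ne.symm h1]
  simp_rw [h]
  rw [Summable.tsum_finsetSum fun _ _ => ENNReal.summable]
  exact Finset.sum_congr rfl fun v _ => tsum_ite_eq _ _

/-- With τ the first visit time to `z` after time 0, `survival` at `n` is P(τ > n), and P(τ = n + 1)
= P(τ > n) - P(τ > n + 1). This replaces sums over states in `ℝ≥0∞` by finite real sums over inputs.
-/
theorem firstPassage_drivenKernel (hμ : ∀ v, 0 ≤ μ v) (hsum : ∑ v, μ v = 1) (z : S) (n : ℕ)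
    (x : S) : firstPassage (drivenKernel T μ) z (n + 1) x =
      ENNReal.ofReal (survival T μ z n x - survival T μ z (n + 1) x) := by
  classical
  induction n generalizing x with
  | zero =>
    simp only [firstPassage, survival, mul_one, drivenKernel]
    rw [← hsum, ← Finset.sum_sub_distrib, ENNReal.ofReal_sum_of_nonneg]
    · refine Finset.sum_congr rfl fun v _ => ?_
      split_ifs <;> simp
    · intro v _
      split_ifs <;> simp [hμ v]
  | succ n ih =>
    rw [firstPassage]
    simp_rw [ih]
    rw [tsum_drivenKernel, survival.eq_2 T μ z x n, survival.eq_2 T μ z x (n + 1),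
      ← Finset.sum_sub_distrib, ENNReal.ofReal_sum_of_nonneg]
    · refine Finset.sum_congr rfl fun v _ => ?_
      split_ifs
      · simp
      · rw [← ENNReal.ofReal_mul (hμ v), mul_sub]
    · intro v _
      split_ifs
      · simp
      · rw [← mul_sub]
        exact mul_nonneg (hμ v) (sub_nonneg.2 (survival_succ_le hμ hsum z n _))

theorem tsum_firstPassage (hμ : ∀ v, 0 ≤ μ v) (hsum : ∑ v, μ v = 1) (z x : S) (g : ℕ → ℝ≥0∞) :
    ∑' n, g n * firstPassage (drivenKernel T μ) z n x =
      ∑' n, g (n + 1) * ENNReal.ofReal (survival T μ z n x - survival T μ z (n + 1) x) := by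
  rw [tsum_eq_zero_add' ENNReal.summable]
  simp [firstPassage, firstPassage_drivenKernel hμ hsum]

/-- Summation by parts, the finite form of E τ = ∑ P(τ > n). -/
theorem sum_succ_mul_survival_sub (z x : S) (N : ℕ) :
    ∑ n ∈ Finset.range N, ((n : ℝ) + 1) * (survival T μ z n x - survival T μ z (n + 1) x) =
      ∑ n ∈ Finset.range N, survival T μ z n x - N * survival T μ z N x := by
  induction N with
  | zero => simp
  | succ N ih =>
    rw [Finset.sum_range_succ, Finset.sum_range_succ, ih]
    push_cast
    ring

/-- Bounded partial sums of the survival function give a finite mean return time. -/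
theorem return_of_sum_survival_le (hμ : ∀ v, 0 ≤ μ v) (hsum : ∑ v, μ v = 1) (x : S) (K : ℝ)
    (hK : ∀ N, ∑ n ∈ Finset.range N, survival T μ x n x ≤ K) :
    ∑' n, firstPassage (drivenKernel T μ) x n x = 1 ∧
      ∑' n : ℕ, (n : ℝ≥0∞) * firstPassage (drivenKernel T μ) x n x < ∞ := by
  have hnn := fun n => survival_nonneg (T := T) hμ x n x
  have hd : ∀ n, 0 ≤ survival T μ x n x - survival T μ x (n + 1) x := fun n =>
    sub_nonneg.2 (survival_succ_le hμ hsum x n x)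
  constructor
  · have h0 : Tendsto (fun n => survival T μ x n x) atTop (𝓝 0) :=
      (summable_of_sum_range_le hnn hK).tendsto_atTop_zero
    have hs : HasSum (fun n => survival T μ x n x - survival T μ x (n + 1) x) 1 := by
      rw [hasSum_iff_tendsto_nat_of_nonneg hd]
      simp_rw [Finset.sum_range_sub']
      simpa [survival] using h0.const_sub 1
    have := tsum_firstPassage (T := T) hμ hsum x x 1
    simp only [Pi.one_apply, one_mul] at this
    rw [this, ← ENNReal.ofReal_tsum_of_nonneg hd hs.summable, hs.tsum_eq, ENNReal.ofReal_one]
  · rw [tsum_firstPassage hμ hsum x x fun n => (n : ℝ≥0∞)]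
    refine lt_of_le_of_lt (b := ENNReal.ofReal K) ?_ ENNReal.ofReal_lt_top
    refine ENNReal.tsum_le_of_sum_range_le fun N => ?_
    have hterm : ∀ n : ℕ, ((n + 1 : ℕ) : ℝ≥0∞) *
        ENNReal.ofReal (survival T μ x n x - survival T μ x (n + 1) x) =
        ENNReal.ofReal (((n : ℝ) + 1) *
          (survival T μ x n x - survival T μ x (n + 1) x)) := by
      intro n
      rw [ENNReal.ofReal_mul (by positivity), ← Nat.cast_succ, ENNReal.ofReal_natCast]
    simp_rw [hterm]
    rw [← ENNReal.ofReal_sum_of_nonneg fun n _ => mul_nonneg (by positivity) (hd n),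
      sum_succ_mul_survival_sub]
    exact ENNReal.ofReal_le_ofReal
      ((sub_le_self _ (mul_nonneg N.cast_nonneg (hnn N))).trans (hK N))

/-- As E τ is finite, n P(τ > n) is at most the tail beyond n of the series for E τ. -/
theorem tendsto_mul_survival (hμ : ∀ v, 0 ≤ μ v) (hsum : ∑ v, μ v = 1)
    (h : PositiveRecurrent (drivenKernel T μ)) (x : S) :
    Tendsto (fun n : ℕ => (n : ℝ) * survival T μ x n x) atTop (𝓝 0) := by
  obtain ⟨h1, h2⟩ := h x
  have hd : ∀ n, 0 ≤ survival T μ x n x - survival T μ x (n + 1) x := fun n =>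
    sub_nonneg.2 (survival_succ_le hμ hsum x n x)
  set d := fun n => survival T μ x n x - survival T μ x (n + 1) x
  have e1 := tsum_firstPassage (T := T) hμ hsum x x 1
  simp only [Pi.one_apply, one_mul] at e1
  rw [h1] at e1
  rw [tsum_firstPassage hμ hsum x x fun n => (n : ℝ≥0∞)] at h2
  have hterm : ∀ n : ℕ, ((n + 1 : ℕ) : ℝ≥0∞) * ENNReal.ofReal (d n) =
      ENNReal.ofReal (((n : ℝ) + 1) * d n) := by
    intro n
    rw [ENNReal.ofReal_mul (by positivity), ← Nat.cast_succ, ENNReal.ofReal_natCast]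
  have hs1 : Summable d := by
    have := ENNReal.summable_toReal (f := fun n => ENNReal.ofReal (d n)) (by
      rw [← e1]; exact ENNReal.one_ne_top)
    exact this.congr fun n => ENNReal.toReal_ofReal (hd n)
  have hs2 : Summable fun n : ℕ => ((n : ℝ) + 1) * d n := by
    have := ENNReal.summable_toReal (f := fun n : ℕ => ENNReal.ofReal (((n : ℝ) + 1) * d n)) (by
      simp_rw [← hterm]; exact h2.ne)
    exact this.congr fun n =>
      ENNReal.toReal_ofReal (mul_nonneg (Nat.cast_add_one_pos n).le (hd n))
  have ht1 : ∑' n, d n = 1 := by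
    rw [← ENNReal.ofReal_tsum_of_nonneg hd hs1] at e1
    exact (ENNReal.ofReal_eq_one.1 e1.symm)
  have hsurv : ∀ N, survival T μ x N x = ∑' n, d (n + N) := by
    intro N
    have e := hs1.sum_add_tsum_nat_add N
    have e0 : ∑ n ∈ Finset.range N, d n = 1 - survival T μ x N x := Finset.sum_range_sub' _ N
    rw [ht1, e0] at e
    linarith
  refine squeeze_zero (fun n => mul_nonneg n.cast_nonneg (survival_nonneg hμ x n x))
    (fun N => ?_) (tendsto_sum_nat_add fun n : ℕ => ((n : ℝ) + 1) * d n)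
  rw [hsurv, ← tsum_mul_left]
  refine Summable.tsum_le_tsum (fun n => ?_) (((summable_nat_add_iff N).2 hs1).mul_left _)
    ((summable_nat_add_iff N).2 hs2)
  refine mul_le_mul_of_nonneg_right ?_ (hd _)
  push_cast
  linarith [n.cast_nonneg (α := ℝ)]

/-! ### Drift criteria -/

/-- A positive recurrent driven chain has no function with increments bounded above and
nonnegative drift, the drift being positive at some point. -/
theorem not_positiveRecurrent_of_drift (hμ : ∀ v, 0 ≤ μ v) (hsum : ∑ v, μ v = 1) (f : S → ℝ)
    (K : ℝ) (x₀ : S) (hf : ∀ x v, f (T x v) ≤ f x + K) (hdrift : ∀ x, f x ≤ ∑ v, μ v * f (T x v))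
    (hpos : f x₀ < ∑ v, μ v * f (T x₀ v)) : ¬ PositiveRecurrent (drivenKernel T μ) := by
  classical
  intro h
  -- The transition operator killed on reaching `x₀`. Since `f₀` vanishes at `x₀`, killing does not
  -- affect the first step, so `f₀ ≤ Q f₀` and the iterates of `Q` increase.
  let Q : (S → ℝ) → S → ℝ := fun g x => ∑ v, if T x v = x₀ then 0 else μ v * g (T x v)
  have hQmono : ∀ g g' : S → ℝ, (∀ x, g x ≤ g' x) → ∀ x, Q g x ≤ Q g' x := by
    intro g g' hg x
    refine Finset.sum_le_sum fun v _ => ?_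
    split_ifs
    exacts [le_rfl, mul_le_mul_of_nonneg_left (hg _) (hμ v)]
  let f₀ : S → ℝ := fun x => f x - f x₀
  have hQ1 : ∀ x, Q f₀ x = (∑ v, μ v * f (T x v)) - f x₀ := by
    intro x
    have e : f x₀ = ∑ v, μ v * f x₀ := by rw [← Finset.sum_mul, hsum, one_mul]
    conv_rhs => rw [e, ← Finset.sum_sub_distrib]
    refine Finset.sum_congr rfl fun v _ => ?_
    split_ifs with hv
    · simp [hv]
    · simp only [f₀]; ring
  let m : ℕ → S → ℝ := fun n => Q^[n] f₀
  have hm : ∀ n, m (n + 1) = Q (m n) := fun n => Function.iterate_succ_apply' Q n f₀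
  have hmono : ∀ n x, m n x ≤ m (n + 1) x := by
    intro n
    induction n with
    | zero =>
      intro x
      rw [hm]
      exact (sub_le_sub_right (hdrift x) _).trans (hQ1 x).ge
    | succ n ih =>
      intro x
      rw [hm, hm (n + 1)]
      exact hQmono _ _ ih x
  have hlow : ∀ n, m 1 x₀ ≤ m (n + 1) x₀ := fun n =>
    monotone_nat_of_le_succ (fun n => hmono n x₀) (Nat.le_add_left 1 n)
  -- Before the return to `x₀`, the function has grown by at most `K` per step. At `x₀` this bounds
  -- the iterates by K n P(τ > n), which tends to 0, whereas they stay above the positive drift `m 1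
  -- x₀`.
  have hup : ∀ (n : ℕ) x, m n x ≤ (f₀ x + K * n) * survival T μ x₀ n x := by
    intro n
    induction n with
    | zero => intro x; simp [m, survival]
    | succ n ih =>
      intro x
      rw [hm, survival, Finset.mul_sum]
      refine Finset.sum_le_sum fun v _ => ?_
      split_ifs
      · simp
      · have h1 := mul_le_mul_of_nonneg_left (ih (T x v)) (hμ v)
        refine h1.trans ?_
        have h2 := mul_nonneg (hμ v) (survival_nonneg (T := T) hμ x₀ n (T x v))
        have h3 : f₀ (T x v) + K * n ≤ f₀ x + K * ((n + 1 : ℕ) : ℝ) := by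
          have := hf x v
          simp only [f₀]
          push_cast
          linarith
        calc _ = (f₀ (T x v) + K * n) * (μ v * survival T μ x₀ n (T x v)) := by ring
          _ ≤ _ := mul_le_mul_of_nonneg_right h3 h2
  have hlim : Tendsto (fun n : ℕ => K * ((n : ℝ) * survival T μ x₀ n x₀)) atTop (𝓝 0) := by
    simpa using (tendsto_mul_survival hμ hsum h x₀).const_mul K
  have hε : 0 < m 1 x₀ := by
    have : m 1 x₀ = Q f₀ x₀ := rfl
    rw [this, hQ1]
    linarith
  obtain ⟨n, hn⟩ := ((tendsto_order.1 (hlim.comp (tendsto_add_atTop_nat 1))).2 _ hε).exists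
  have h1 := hlow n
  have h2 := hup (n + 1) x₀
  simp only [Function.comp_apply] at hn
  have h3 : f₀ x₀ = 0 := sub_self _
  rw [h3, zero_add, mul_assoc] at h2
  linarith

/-- The Foster–Lyapunov criterion. -/
theorem positiveRecurrent_of_drift (hμ : ∀ v, 0 ≤ μ v) (hsum : ∑ v, μ v = 1)
    (hirr : ∀ z x : S, ∃ n, survival T μ z n x < 1)
    (f : S → ℝ) (hf : ∀ x, 0 ≤ f x) {C : Set S} (hC : C.Finite) (ε L : ℝ) (hε : 0 < ε)
    (hL : ∀ x, ∑ v, μ v * f (T x v) ≤ f x + L)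
    (hdrift : ∀ x ∉ C, ∑ v, μ v * f (T x v) ≤ f x - ε) :
    PositiveRecurrent (drivenKernel T μ) := by
  classical
  intro z
  choose n hn using hirr z
  obtain ⟨N, hN⟩ : ∃ N, ∀ x ∈ C, n x ≤ N := by
    obtain ⟨N, hN⟩ := (hC.image n).bddAbove
    exact ⟨N, fun x hx => hN ⟨x, hx, rfl⟩⟩
  have hlt : ∀ x ∈ C, survival T μ z N x < 1 := fun x hx =>
    (survival_antitone hμ hsum z x (hN x hx)).trans_lt (hn x)
  obtain ⟨B, hB0, hB⟩ : ∃ B : ℝ, 0 ≤ B ∧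
      ∀ x ∈ C, 1 + ε⁻¹ * L ≤ B * (1 - survival T μ z N x) := by
    obtain ⟨B, hB⟩ :=
      (hC.image fun x => (1 + ε⁻¹ * L) / (1 - survival T μ z N x)).bddAbove
    refine ⟨max B 0, le_max_right _ _, fun x hx => ?_⟩
    have h1 := sub_pos.2 (hlt x hx)
    rw [← div_le_iff₀ h1]
    exact (hB ⟨x, hx, rfl⟩).trans (le_max_left _ _)
  -- This is E min(τ, N). Its killed mean decreases by P(τ ≤ N), which is positive on `C`; the
  -- multiple `B` thereby absorbs the possible increase of `f` on `C`.
  let w : S → ℝ := fun x => ∑ k ∈ Finset.range N, survival T μ z k x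
  have hw0 : ∀ x, 0 ≤ w x := fun x => Finset.sum_nonneg fun k _ => survival_nonneg hμ z k x
  have hw : ∀ x, (∑ v, if T x v = z then 0 else μ v * w (T x v)) =
      w x - (1 - survival T μ z N x) := by
    intro x
    have e1 : (∑ v, if T x v = z then 0 else μ v * w (T x v)) =
        ∑ k ∈ Finset.range N, survival T μ z (k + 1) x := by
      simp only [survival]
      rw [Finset.sum_comm]
      refine Finset.sum_congr rfl fun v _ => ?_
      split_ifs
      · simp
      · rw [Finset.mul_sum]
    have e2 := Finset.sum_range_succ (fun k => survival T μ z k x) N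
    rw [Finset.sum_range_succ'] at e2
    have e3 : survival T μ z 0 x = 1 := rfl
    rw [e1]
    simp only [w]
    linarith
  let W : S → ℝ := fun x => ε⁻¹ * f x + B * w x
  have hεi := inv_pos.2 hε
  have hW : ∀ x, 1 + (∑ v, if T x v = z then 0 else μ v * W (T x v)) ≤ W x := by
    intro x
    have h1 : (∑ v, if T x v = z then 0 else μ v * W (T x v)) ≤
        ε⁻¹ * (∑ v, μ v * f (T x v)) + B * ∑ v, if T x v = z then 0 else μ v * w (T x v) := by
      rw [Finset.mul_sum, Finset.mul_sum, ← Finset.sum_add_distrib]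
      refine Finset.sum_le_sum fun v _ => ?_
      split_ifs
      · have := mul_nonneg hεi.le (mul_nonneg (hμ v) (hf (T x v)))
        linarith
      · simp only [W]
        linarith
    rw [hw] at h1
    have hs := survival_le_one (T := T) hμ hsum z N x
    by_cases hx : x ∈ C
    · have h2 := mul_le_mul_of_nonneg_left (hL x) hεi.le
      have h3 := hB x hx
      simp only [W]
      linarith
    · have h2 := mul_le_mul_of_nonneg_left (hdrift x hx) hεi.le
      rw [mul_sub, inv_mul_cancel₀ hε.ne'] at h2
      have h3 := mul_nonneg hB0 (sub_nonneg.2 hs)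
      simp only [W]
      linarith
  refine return_of_sum_survival_le hμ hsum z (W z) fun M => ?_
  -- Iterating 1 + QW ≤ W, with Q the transition operator killed at `z`, bounds the partial sums of
  -- P(τ > k) by `W`.
  have key : ∀ (M : ℕ) x, ∑ k ∈ Finset.range M, survival T μ z k x ≤ W x := by
    intro M
    induction M with
    | zero =>
      intro x
      simpa using add_nonneg (mul_nonneg hεi.le (hf x)) (mul_nonneg hB0 (hw0 x))
    | succ M ih =>
      intro x
      rw [Finset.sum_range_succ', add_comm]
      refine le_trans (add_le_add le_rfl ?_) (hW x)
      simp only [survival]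
      rw [Finset.sum_comm]
      refine Finset.sum_le_sum fun v _ => ?_
      split_ifs
      · simp
      · rw [← Finset.mul_sum]
        exact mul_le_mul_of_nonneg_left (ih _) (hμ v)
  exact key M z

/-- An input leading to `z`, or to a state from which `z` is reached with positive probability. -/
theorem exists_survival_lt_one_of_step (hμ : ∀ v, 0 < μ v) (hsum : ∑ v, μ v = 1) {z x : S} (v : V)
    (h : T x v = z ∨ ∃ n, survival T μ z n (T x v) < 1) : ∃ n, survival T μ z n x < 1 := by
  classical
  have hμ' := fun v => (hμ v).le
  have key : ∀ n, (T x v = z ∨ survival T μ z n (T x v) < 1) → survival T μ z (n + 1) x < 1 := by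
    intro n hn
    rw [survival, ← hsum]
    refine Finset.sum_lt_sum (fun w _ => ?_) ⟨v, Finset.mem_univ v, ?_⟩
    · split_ifs
      exacts [hμ' w, mul_le_of_le_one_right (hμ' w) (survival_le_one hμ' hsum _ _ _)]
    · split_ifs with hv
      exacts [hμ v, mul_lt_of_lt_one_right (hμ v) (hn.resolve_left hv)]
  rcases h with h | ⟨n, hn⟩
  exacts [⟨1, key 0 (Or.inl h)⟩, ⟨n + 1, key n (Or.inr hn)⟩]

end Driven

/-! ### Transitions and irreducibility -/

theorem MatchingPolicy.step_counts {V : Type*} [DecidableEq V] {G : SimpleGraph V}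
    (Φ : MatchingPolicy G) (u : Buffer G) (v : V) :
    ((∀ j, G.Adj v j → u.counts j = 0) ∧
        ∀ i, (Φ.step u v).counts i = u.counts i + if v = i then 1 else 0) ∨
      ∃ j, G.Adj v j ∧ 0 < u.counts j ∧
        ∀ i, u.counts i = (Φ.step u v).counts i + if j = i then 1 else 0 := by
  by_cases h : ∃ j ∈ u.1, G.Adj v j
  · obtain ⟨x, j, y, hadj, hu, hs⟩ := Φ.step_of_matched u v h
    refine Or.inr ⟨j, hadj, ?_, fun i => ?_⟩
    · simp [Buffer.counts, hu]
    · by_cases hij : j = i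
      · subst hij
        simp [Buffer.counts, hu, hs]
        omega
      · simp [Buffer.counts, hu, hs, hij]
  · push Not at h
    refine Or.inl ⟨fun j hj => List.count_eq_zero.2 fun hm => h j hm hj, fun i => ?_⟩
    simp [Buffer.counts, Φ.step_of_unmatched u v h, List.count_append, List.count_singleton]

/-- The empty buffer. -/
def Buffer.empty {V : Type*} [DecidableEq V] (G : SimpleGraph V) : Buffer G :=
  ⟨[], fun _ _ _ => by simp⟩

theorem graph_adj (i j : Cls) : graph.Adj i j ↔
    (i, j) ∈ ([(.c1, .c2), (.c2, .c1), (.c2, .c3), (.c3, .c2), (.c2, .c4), (.c4, .c2),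
      (.c3, .c4), (.c4, .c3)] : List (Cls × Cls)) := by
  cases i <;> cases j <;> simp [graph]

theorem exists_graph_adj (i : Cls) : ∃ j, graph.Adj j i := by
  cases i
  exacts [⟨.c2, by simp [graph_adj]⟩, ⟨.c1, by simp [graph_adj]⟩, ⟨.c2, by simp [graph_adj]⟩,
    ⟨.c2, by simp [graph_adj]⟩]

/-- From any buffer the empty one is reachable: an arrival compatible with the oldest item removes
some item, whatever the policy. From the empty buffer, the letters of `z` arriving in order are all
stored and build `z`. -/
theorem irreducible (Φ : MatchingPolicy graph) {μ : Cls → ℝ} (hμ : ∀ v, 0 < μ v)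
    (hsum : ∑ v, μ v = 1) (z x : Buffer graph) : ∃ n, survival Φ.step μ z n x < 1 := by
  have hstep := fun (x : Buffer graph) v => exists_survival_lt_one_of_step (T := Φ.step)
    (z := z) (x := x) hμ hsum v
  have hempty : ∃ n, survival Φ.step μ z n (Buffer.empty graph) < 1 := by
    -- Visits count only from time 1 on, so an empty target needs a genuine excursion: an arrival of
    -- class 1, then of class 2.
    by_cases hz : z.1 = []
    · have h1 : (Φ.step (Buffer.empty graph) .c1).1 = [.c1] :=
        Φ.step_of_unmatched _ _ (by simp [Buffer.empty])
      refine hstep _ .c1 (Or.inr (hstep _ .c2 (Or.inl (Subtype.ext ?_))))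
      obtain ⟨p, j, q, -, hu, hs⟩ := Φ.step_of_matched (Φ.step (Buffer.empty graph) .c1) .c2
        ⟨.c1, by simp [h1], by simp [graph_adj]⟩
      rw [h1] at hu
      have hl := congrArg List.length hu
      simp only [List.length_append, List.length_cons, List.length_nil] at hl
      rw [hs, hz, ← List.length_eq_zero_iff, List.length_append]
      omega
    · have key : ∀ (q p : List Cls) (u : Buffer graph), u.1 = p → z.1 = p ++ q → q ≠ [] →
          ∃ n, survival Φ.step μ z n u < 1 := by
        intro q
        induction q with
        | nil => intro p u _ _ h; exact absurd rfl h
        | cons v q ih =>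
          intro p u hu hzq _
          have hs : (Φ.step u v).1 = p ++ [v] := by
            rw [← hu]
            refine Φ.step_of_unmatched u v fun j hj hadj => ?_
            have h1 := z.2 v j hadj
            rw [hzq, ← hu] at h1
            have h2 := List.count_pos_iff.2 hj
            simp only [List.count_append, List.count_cons_self] at h1
            rcases Nat.mul_eq_zero.1 h1 with h | h <;> omega
          refine hstep u v ?_
          by_cases hq : q = []
          · exact Or.inl (Subtype.ext (by rw [hs, hzq, hq]))
          · exact Or.inr (ih (p ++ [v]) _ hs (by simp [hzq]) hq)
      exact key z.1 [] _ rfl rfl hz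
  induction hn : x.1.length using Nat.strong_induction_on generalizing x with
  | _ n ih =>
    subst hn
    rcases hx : x.1 with _ | ⟨i, l⟩
    · have : x = Buffer.empty graph := Subtype.ext hx
      rwa [this]
    · obtain ⟨v, hv⟩ := exists_graph_adj i
      obtain ⟨p, j, q, -, hu, hs⟩ := Φ.step_of_matched x v ⟨i, by simp [hx], hv⟩
      refine hstep x v (Or.inr (ih _ ?_ _ rfl))
      rw [hu, hs]
      simp

/-! ### Drifts -/

/-- The value of a function of the numbers of items of class `1`, of class `2`, and of classes
`3` and `4` together. -/
def Buffer.val (f : ℝ → ℝ → ℝ → ℝ) (u : Buffer graph) : ℝ :=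
  f (u.counts .c1) (u.counts .c2) (u.counts .c3 + u.counts .c4)

theorem Buffer.val_eq {f : ℝ → ℝ → ℝ → ℝ} {u : Buffer graph} {x n y : ℝ}
    (hx : (u.counts .c1 : ℝ) = x) (hn : (u.counts .c2 : ℝ) = n)
    (hy : (u.counts .c3 : ℝ) + u.counts .c4 = y) : u.val f = f x n y := by
  rw [Buffer.val, hx, hn, hy]

theorem sum_cls (F : Cls → ℝ) : ∑ v, F v = F .c1 + F .c2 + (F .c3 + F .c4) := by
  have : (Finset.univ : Finset Cls) = {.c1, .c2, .c3, .c4} := rfl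
  rw [this]
  simp [add_assoc]

theorem step_c1 (Φ : MatchingPolicy graph) (u : Buffer graph) (f : ℝ → ℝ → ℝ → ℝ) :
    (u.counts .c2 = 0 ∧ (Φ.step u .c1).val f =
        f (u.counts .c1 + 1) (u.counts .c2) (u.counts .c3 + u.counts .c4)) ∨
      (0 < u.counts .c2 ∧ (Φ.step u .c1).val f =
        f (u.counts .c1) (u.counts .c2 - 1) (u.counts .c3 + u.counts .c4)) := by
  rcases Φ.step_counts u .c1 with ⟨h0, h⟩ | ⟨j, hj, hp, h⟩
  · refine Or.inl ⟨h0 _ (by simp [graph_adj]), Buffer.val_eq ?_ ?_ ?_⟩ <;> simp [h]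
  · obtain rfl : j = .c2 := by revert hj; cases j <;> simp [graph_adj]
    refine Or.inr ⟨hp, Buffer.val_eq ?_ ?_ ?_⟩ <;> simp [h]

theorem step_c2 (Φ : MatchingPolicy graph) (u : Buffer graph) (f : ℝ → ℝ → ℝ → ℝ) :
    (u.counts .c1 = 0 ∧ u.counts .c3 = 0 ∧ u.counts .c4 = 0 ∧ (Φ.step u .c2).val f =
        f (u.counts .c1) (u.counts .c2 + 1) (u.counts .c3 + u.counts .c4)) ∨
      (0 < u.counts .c1 ∧ u.counts .c1 = (Φ.step u .c2).counts .c1 + 1 ∧ (Φ.step u .c2).val f =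
        f (u.counts .c1 - 1) (u.counts .c2) (u.counts .c3 + u.counts .c4)) ∨
      (0 < u.counts .c3 + u.counts .c4 ∧ u.counts .c1 = (Φ.step u .c2).counts .c1 ∧
        (Φ.step u .c2).val f =
        f (u.counts .c1) (u.counts .c2) (u.counts .c3 + u.counts .c4 - 1)) := by
  rcases Φ.step_counts u .c2 with ⟨h0, h⟩ | ⟨j, hj, hp, h⟩
  · refine Or.inl ⟨h0 _ (by simp [graph_adj]), h0 _ (by simp [graph_adj]),
      h0 _ (by simp [graph_adj]), Buffer.val_eq ?_ ?_ ?_⟩ <;> simp [h]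
  · obtain rfl | rfl | rfl : j = .c1 ∨ j = .c3 ∨ j = .c4 := by
      revert hj; cases j <;> simp [graph_adj]
    · refine Or.inr (Or.inl ⟨hp, by simp [h], Buffer.val_eq ?_ ?_ ?_⟩) <;> simp [h]
    · refine Or.inr (Or.inr ⟨by omega, by simp [h], Buffer.val_eq ?_ ?_ ?_⟩) <;> simp [h]
      ring
    · refine Or.inr (Or.inr ⟨by omega, by simp [h], Buffer.val_eq ?_ ?_ ?_⟩) <;> simp [h]
      ring

theorem step_c3 (Φ : MatchingPolicy graph) (u : Buffer graph) (f : ℝ → ℝ → ℝ → ℝ) :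
    (u.counts .c2 = 0 ∧ u.counts .c4 = 0 ∧ (Φ.step u .c3).val f =
        f (u.counts .c1) (u.counts .c2) (u.counts .c3 + u.counts .c4 + 1)) ∨
      (0 < u.counts .c2 ∧ (Φ.step u .c3).val f =
        f (u.counts .c1) (u.counts .c2 - 1) (u.counts .c3 + u.counts .c4)) ∨
      (0 < u.counts .c4 ∧ (Φ.step u .c3).val f =
        f (u.counts .c1) (u.counts .c2) (u.counts .c3 + u.counts .c4 - 1)) := by
  rcases Φ.step_counts u .c3 with ⟨h0, h⟩ | ⟨j, hj, hp, h⟩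
  · refine Or.inl ⟨h0 _ (by simp [graph_adj]), h0 _ (by simp [graph_adj]),
      Buffer.val_eq ?_ ?_ ?_⟩ <;> simp [h]
    ring
  · obtain rfl | rfl : j = .c2 ∨ j = .c4 := by revert hj; cases j <;> simp [graph_adj]
    · refine Or.inr (Or.inl ⟨hp, Buffer.val_eq ?_ ?_ ?_⟩) <;> simp [h]
    · refine Or.inr (Or.inr ⟨hp, Buffer.val_eq ?_ ?_ ?_⟩) <;> simp [h]
      ring

theorem step_c4 (Φ : MatchingPolicy graph) (u : Buffer graph) (f : ℝ → ℝ → ℝ → ℝ) :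
    (u.counts .c2 = 0 ∧ u.counts .c3 = 0 ∧ (Φ.step u .c4).val f =
        f (u.counts .c1) (u.counts .c2) (u.counts .c3 + u.counts .c4 + 1)) ∨
      (0 < u.counts .c2 ∧ (Φ.step u .c4).val f =
        f (u.counts .c1) (u.counts .c2 - 1) (u.counts .c3 + u.counts .c4)) ∨
      (0 < u.counts .c3 ∧ (Φ.step u .c4).val f =
        f (u.counts .c1) (u.counts .c2) (u.counts .c3 + u.counts .c4 - 1)) := by
  rcases Φ.step_counts u .c4 with ⟨h0, h⟩ | ⟨j, hj, hp, h⟩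
  · refine Or.inl ⟨h0 _ (by simp [graph_adj]), h0 _ (by simp [graph_adj]),
      Buffer.val_eq ?_ ?_ ?_⟩ <;> simp [h]
    ring
  · obtain rfl | rfl : j = .c2 ∨ j = .c3 := by revert hj; cases j <;> simp [graph_adj]
    · refine Or.inr (Or.inl ⟨hp, Buffer.val_eq ?_ ?_ ?_⟩) <;> simp [h]
    · refine Or.inr (Or.inr ⟨hp, Buffer.val_eq ?_ ?_ ?_⟩) <;> simp [h]
      ring

theorem step_counts_le (Φ : MatchingPolicy graph) (u : Buffer graph) (v i : Cls) :
    ((Φ.step u v).counts i : ℝ) ≤ u.counts i + 1 ∧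
      (u.counts i : ℝ) ≤ (Φ.step u v).counts i + 1 := by
  have : (Φ.step u v).counts i ≤ u.counts i + 1 ∧ u.counts i ≤ (Φ.step u v).counts i + 1 := by
    rcases Φ.step_counts u v with ⟨-, h⟩ | ⟨j, -, -, h⟩ <;> have := h i <;> split_ifs at this <;>
      omega
  exact_mod_cast this

/-- The buffer contents, by the classes present, with the corresponding one-step means. -/
theorem mean_step_cases (Φ : MatchingPolicy graph) {μ : Cls → ℝ} (h34 : μ .c3 = μ .c4)
    (f : ℝ → ℝ → ℝ → ℝ) (u : Buffer graph) :
    ∃ x n y D : ℝ, (u.counts .c1 : ℝ) = x ∧ (u.counts .c2 : ℝ) = n ∧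
      (u.counts .c3 : ℝ) + u.counts .c4 = y ∧ ∑ v, μ v * (Φ.step u v).val f = D ∧
    ((x = 0 ∧ n = 0 ∧ y = 0 ∧ D = μ .c1 * f 1 0 0 + μ .c2 * f 0 1 0 + 2 * μ .c4 * f 0 0 1) ∨
    (1 ≤ n ∧ x = 0 ∧ y = 0 ∧
      D = μ .c2 * f 0 (n + 1) 0 + (μ .c1 + 2 * μ .c4) * f 0 (n - 1) 0) ∨
    (1 ≤ x ∧ n = 0 ∧ y = 0 ∧
      D = μ .c1 * f (x + 1) 0 0 + μ .c2 * f (x - 1) 0 0 + 2 * μ .c4 * f x 0 1) ∨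
    (1 ≤ y ∧ n = 0 ∧ x = 0 ∧ D = μ .c1 * f 1 0 y + μ .c2 * f 0 0 (y - 1) +
      (μ .c4 * f 0 0 (y + 1) + μ .c4 * f 0 0 (y - 1))) ∨
    (1 ≤ x ∧ 1 ≤ y ∧ n = 0 ∧ u.counts .c1 = (Φ.step u .c2).counts .c1 + 1 ∧
      D = μ .c1 * f (x + 1) 0 y + μ .c2 * f (x - 1) 0 y +
      (μ .c4 * f x 0 (y + 1) + μ .c4 * f x 0 (y - 1))) ∨
    (1 ≤ x ∧ 1 ≤ y ∧ n = 0 ∧ u.counts .c1 = (Φ.step u .c2).counts .c1 ∧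
      D = μ .c1 * f (x + 1) 0 y + μ .c2 * f x 0 (y - 1) +
      (μ .c4 * f x 0 (y + 1) + μ .c4 * f x 0 (y - 1)))) := by
  -- Class 2 excludes all the others, and 3 excludes 4; only the patterns of the statement remain.
  have e12 : u.counts .c1 * u.counts .c2 = 0 := u.2 _ _ (by simp [graph_adj])
  have e23 : u.counts .c2 * u.counts .c3 = 0 := u.2 _ _ (by simp [graph_adj])
  have e24 : u.counts .c2 * u.counts .c4 = 0 := u.2 _ _ (by simp [graph_adj])
  have e34 : u.counts .c3 * u.counts .c4 = 0 := u.2 _ _ (by simp [graph_adj])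
  have s1 := step_c1 Φ u f
  have s2 := step_c2 Φ u f
  have s3 := step_c3 Φ u f
  have s4 := step_c4 Φ u f
  refine ⟨_, _, _, _, rfl, rfl, rfl, rfl, ?_⟩
  rw [sum_cls, h34]
  rcases Nat.eq_zero_or_pos (u.counts .c2) with h2 | h2
  · simp only [h2, lt_irrefl, false_and, true_and, or_false, false_or] at s1 s3 s4
    rcases Nat.eq_zero_or_pos (u.counts .c1) with h1 | h1
    · rcases Nat.eq_zero_or_pos (u.counts .c3) with h3 | h3 <;>
        rcases Nat.eq_zero_or_pos (u.counts .c4) with h4 | h4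
      · left
        simp [h1, h2, h3, h4] at s1 s2 s3 s4 ⊢
        rw [s1, s2, s3, s4]; ring
      · right; right; right; left
        simp [h1, h2, h3, h4, h4.ne'] at s1 s2 s3 s4 ⊢
        rw [s1, s2.2, s3, s4]
        exact ⟨h4, by ring⟩
      · right; right; right; left
        simp [h1, h2, h3, h4, h3.ne'] at s1 s2 s3 s4 ⊢
        rw [s1, s2.2, s3, s4]
        exact ⟨h3, by ring⟩
      · exact absurd e34 (Nat.mul_pos h3 h4).ne'
    · rcases Nat.eq_zero_or_pos (u.counts .c3) with h3 | h3 <;>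
        rcases Nat.eq_zero_or_pos (u.counts .c4) with h4 | h4
      · right; right; left
        simp [h1, h2, h3, h4, h1.ne'] at s1 s2 s3 s4 ⊢
        rw [s1, s2.2, s3, s4]
        exact ⟨h1, by ring⟩
      · right; right; right; right
        have h4' : (1 : ℝ) ≤ u.counts .c4 := by exact_mod_cast h4
        have h1' : (1 : ℝ) ≤ u.counts .c1 := by exact_mod_cast h1
        simp only [h1, h1.ne', h2, h3, h4, h4.ne', false_and, true_and, false_or, or_false,
          lt_irrefl, zero_add, Nat.cast_zero] at s1 s2 s3 s4 ⊢
        rcases s2 with ⟨hs, s2⟩ | ⟨hs, s2⟩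
        · left
          refine ⟨h1', h4', hs, ?_⟩
          rw [s1, s2, s3, s4]; ring
        · right
          refine ⟨h1', h4', hs, ?_⟩
          rw [s1, s2, s3, s4]; ring
      · right; right; right; right
        have h3' : (1 : ℝ) ≤ u.counts .c3 := by exact_mod_cast h3
        have h1' : (1 : ℝ) ≤ u.counts .c1 := by exact_mod_cast h1
        simp only [h1, h1.ne', h2, h3, h4, h3.ne', false_and, true_and, false_or, or_false,
          lt_irrefl, add_zero, Nat.cast_zero] at s1 s2 s3 s4 ⊢
        rcases s2 with ⟨hs, s2⟩ | ⟨hs, s2⟩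
        · left
          refine ⟨h1', h3', hs, ?_⟩
          rw [s1, s2, s3, s4]
        · right
          refine ⟨h1', h3', hs, ?_⟩
          rw [s1, s2, s3, s4]
      · exact absurd e34 (Nat.mul_pos h3 h4).ne'
  · right; left
    have h1 := (Nat.mul_eq_zero.1 e12).resolve_right h2.ne'
    have h3 := (Nat.mul_eq_zero.1 e23).resolve_left h2.ne'
    have h4 := (Nat.mul_eq_zero.1 e24).resolve_left h2.ne'
    simp [h1, h2, h3, h4, h2.ne'] at s1 s2 s3 s4 ⊢
    rw [s1, s2, s3, s4]
    exact ⟨h2, by ring⟩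

/-! ### Stability regions -/

theorem not_stable_of_drift (Φ : MatchingPolicy graph) {μ : Cls → ℝ} (hμ : μ ∈ posProb Cls)
    (f : ℝ → ℝ → ℝ → ℝ) (K : ℝ)
    (hf : ∀ u v, (Φ.step u v).val f ≤ u.val f + K)
    (hdrift : ∀ u : Buffer graph, u.val f ≤ ∑ v, μ v * (Φ.step u v).val f)
    (hpos : ∃ u : Buffer graph, u.val f < ∑ v, μ v * (Φ.step u v).val f) :
    ¬ PositiveRecurrent (Φ.transition μ) := by
  obtain ⟨u₀, h₀⟩ := hpos
  -- `Φ.transition μ` is by definition the driven kernel of `Φ.step`.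
  exact not_positiveRecurrent_of_drift (fun v => (hμ.1 v).le) hμ.2 (Buffer.val f) K u₀ hf hdrift h₀

/-- The buffer holding a single item. -/
def Buffer.single (i : Cls) : Buffer graph :=
  ⟨[i], fun a b hab => by
    have hne := hab.ne
    by_cases h : i = a
    · subst h; simp [hne]
    · simp [h]⟩

/-! ### Necessary conditions -/

theorem c2_lt_half_of_stable (Φ : MatchingPolicy graph) {μ : Cls → ℝ} (hμ : μ ∈ posProb Cls)
    (h34 : μ .c3 = μ .c4) (h : PositiveRecurrent (Φ.transition μ)) : μ .c2 < 1 / 2 := by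
  by_contra! hb
  have hsum := hμ.2
  rw [sum_cls, h34] at hsum
  have h2 := hμ.1 .c2
  refine not_stable_of_drift Φ hμ (fun _ n _ => n) 1 (fun u v => ?_) (fun u => ?_)
    ⟨Buffer.empty graph, ?_⟩ h
  · exact (step_counts_le Φ u v .c2).1
  · obtain ⟨x, n, y, D, hx, hn, hy, hD, hc⟩ := mean_step_cases Φ h34 (fun _ n _ => n) u
    rw [hD, Buffer.val_eq hx hn hy]
    rcases hc with ⟨-, hc, -, rfl⟩ | ⟨hc, -, -, rfl⟩ | ⟨-, hc, -, rfl⟩ | ⟨-, hc, -, rfl⟩ |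
      ⟨-, -, hc, -, rfl⟩ | ⟨-, -, hc, -, rfl⟩ <;> nlinarith
  · obtain ⟨x, n, y, D, hx, hn, hy, hD, hc⟩ :=
      mean_step_cases Φ h34 (fun _ n _ => n) (Buffer.empty graph)
    rw [hD, Buffer.val_eq hx hn hy]
    simp only [Buffer.empty, Buffer.counts, List.count_nil, Nat.cast_zero] at hx hn hy
    rcases hc with ⟨-, hc, -, rfl⟩ | ⟨hc, -, -, rfl⟩ | ⟨hc, -, -, rfl⟩ | ⟨hc, -, -, rfl⟩ |
      ⟨hc, -, -, -, rfl⟩ | ⟨hc, -, -, -, rfl⟩ <;> linarith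

/-- Instability through the function `x + α * y - n`. -/
theorem not_stable_of_linear (Φ : MatchingPolicy graph) {μ : Cls → ℝ} (hμ : μ ∈ posProb Cls)
    (h34 : μ .c3 = μ .c4) (α : ℝ) (hα : 0 ≤ α) (hb : μ .c2 < 1 / 2)
    (h0 : 0 ≤ μ .c1 - μ .c2 + 2 * μ .c4 * α)
    (h3 : 0 ≤ μ .c1 - μ .c2 * α)
    (h13 : 0 ≤ μ .c1 - μ .c2 ∨ ∀ u : Buffer graph, 0 < (u.counts .c3 : ℝ) + u.counts .c4 →
      u.counts .c1 = (Φ.step u .c2).counts .c1) :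
    ¬ PositiveRecurrent (Φ.transition μ) := by
  have hsum := hμ.2
  rw [sum_cls, h34] at hsum
  refine not_stable_of_drift Φ hμ (fun x n y => x + α * y - n) (2 + 2 * α) (fun u v => ?_)
    (fun u => ?_) ⟨Buffer.single .c2, ?_⟩
  · have := (step_counts_le Φ u v .c1).1
    have := (step_counts_le Φ u v .c2).2
    have h3 := mul_le_mul_of_nonneg_left (step_counts_le Φ u v .c3).1 hα
    have h4 := mul_le_mul_of_nonneg_left (step_counts_le Φ u v .c4).1 hα
    simp only [Buffer.val]
    linarith
  · obtain ⟨x, n, y, D, hx, hn, hy, hD, hc⟩ :=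
      mean_step_cases Φ h34 (fun x n y => x + α * y - n) u
    rw [hD, Buffer.val_eq hx hn hy]
    -- Once μ(1) is eliminated, the products of weights with x, n, y cancel and the inequalities
    -- become linear in the remaining monomials.
    have e1 : μ .c1 = 1 - μ .c2 - 2 * μ .c4 := by linarith
    rw [e1] at h0 h3 h13 hc
    rcases hc with ⟨rfl, rfl, rfl, rfl⟩ | ⟨hc, rfl, rfl, rfl⟩ | ⟨hc, rfl, rfl, rfl⟩ |
      ⟨hc, rfl, rfl, rfl⟩ | ⟨hx1, hy1, rfl, hs, rfl⟩ | ⟨hx1, hy1, rfl, -, rfl⟩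
    · linarith
    · linarith
    · linarith
    · linarith
    · rcases h13 with h13 | h13
      · linarith
      · have := h13 u (by linarith)
        omega
    · linarith
  · obtain ⟨x, n, y, D, hx, hn, hy, hD, hc⟩ :=
      mean_step_cases Φ h34 (fun x n y => x + α * y - n) (Buffer.single .c2)
    rw [hD, Buffer.val_eq hx hn hy]
    have e1 : μ .c1 = 1 - μ .c2 - 2 * μ .c4 := by linarith
    rw [e1] at hc
    simp only [Buffer.single, Buffer.counts, List.count_cons_self, List.count_nil, zero_add,
      Nat.cast_one] at hn
    rcases hc with ⟨-, hc, -, rfl⟩ | ⟨hc, rfl, rfl, rfl⟩ | ⟨-, hc, -, rfl⟩ | ⟨-, hc, -, rfl⟩ |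
      ⟨-, -, hc, -, rfl⟩ | ⟨-, -, hc, -, rfl⟩ <;> linarith

/-- With weight α = 0 the function is x - n, whose drift is at least a - b whatever class 2 prefers.
-/
theorem c1_lt_c2_of_stable (Φ : MatchingPolicy graph) {μ : Cls → ℝ} (hμ : μ ∈ posProb Cls)
    (h34 : μ .c3 = μ .c4) (h : PositiveRecurrent (Φ.transition μ)) : μ .c1 < μ .c2 := by
  by_contra! hab
  have h1 := hμ.1 .c1
  have h4 := hμ.1 .c4
  exact not_stable_of_linear Φ hμ h34 0 le_rfl (c2_lt_half_of_stable Φ hμ h34 h) (by linarith)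
    (by linarith) (Or.inl (by linarith)) h

theorem step_c2_of_policyA {A : MatchingPolicy graph} (hA : IsPolicyA A) (u : Buffer graph)
    (hu : 0 < (u.counts .c3 : ℝ) + u.counts .c4) :
    u.counts .c1 = (A.step u .c2).counts .c1 := by
  obtain ⟨pref, hp, ⟨m3, m1, h31⟩, ⟨m4, _, h41⟩⟩ := hA
  let := pref .c2
  have e34 : u.counts .c3 * u.counts .c4 = 0 := u.2 _ _ (by simp [graph_adj])
  have hu' : 0 < u.counts .c3 + u.counts .c4 := by exact_mod_cast hu
  rcases Nat.mul_eq_zero.1 e34 with h | h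
  · have h4 : 0 < u.counts .c4 := by omega
    have := (hp u .c2).2 ⟨.c4, m4⟩ ⟨h4, by
      rintro ⟨k, hk⟩ (hk0 : 0 < u.counts k)
      cases k
      · exact h41.le
      · exact absurd hk (by simp)
      · omega
      · exact le_refl _⟩
    simp [this]
  · have h3 : 0 < u.counts .c3 := by omega
    have := (hp u .c2).2 ⟨.c3, m3⟩ ⟨h3, by
      rintro ⟨k, hk⟩ (hk0 : 0 < u.counts k)
      cases k
      · exact h31.le
      · exact absurd hk (by simp)
      · exact le_refl _
      · omega⟩
    simp [this]

theorem step_c2_of_policyB {B : MatchingPolicy graph} (hB : IsPolicyB B) (u : Buffer graph)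
    (hu : 0 < u.counts .c1) : u.counts .c1 = (B.step u .c2).counts .c1 + 1 := by
  obtain ⟨pref, hp, ⟨m1, m3, h13⟩, ⟨_, m4, h14⟩⟩ := hB
  let := pref .c2
  have := (hp u .c2).2 ⟨.c1, m1⟩ ⟨hu, by
    rintro ⟨k, hk⟩ (hk0 : 0 < u.counts k)
    cases k
    · exact le_refl _
    · exact absurd hk (by simp)
    · exact h13.le
    · exact h14.le⟩
  simp [this]
  omega

theorem lt_sq_of_policyA_stable {A : MatchingPolicy graph} (hA : IsPolicyA A) {μ : Cls → ℝ}
    (hμ : μ ∈ posProb Cls) (h34 : μ .c3 = μ .c4) (h : PositiveRecurrent (A.transition μ)) :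
    μ .c1 * (1 - μ .c1) < μ .c2 ^ 2 := by
  by_contra! hab
  have hsum := hμ.2
  rw [sum_cls, h34] at hsum
  have h1 := hμ.1 .c1
  have h2 := hμ.1 .c2
  have h4 := hμ.1 .c4
  have hpos : 0 < 1 - μ .c1 := by linarith
  have e : μ .c2 * (μ .c2 / (1 - μ .c1)) ≤ μ .c1 := by
    rw [← mul_div_assoc, div_le_iff₀ hpos]
    linarith
  have e' : μ .c2 / (1 - μ .c1) * (1 - μ .c1) = μ .c2 := div_mul_cancel₀ _ hpos.ne'
  have e4 : 2 * μ .c4 = 1 - μ .c1 - μ .c2 := by linarith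
  -- This weight equalises the drifts a - b + 2cα (for n = y = 0) and a - bα (for y > 0); the
  -- assumption makes the common value nonnegative.
  refine not_stable_of_linear A hμ h34 (μ .c2 / (1 - μ .c1)) (div_nonneg h2.le hpos.le)
    (c2_lt_half_of_stable A hμ h34 h) ?_ (by linarith) (Or.inr (step_c2_of_policyA hA)) h
  rw [e4]
  linarith

/-! ### Sufficient conditions -/

theorem finite_counts_le (R : ℝ) : {u : Buffer graph | (u.counts .c1 : ℝ) + u.counts .c2 +
    (u.counts .c3 + u.counts .c4) ≤ R}.Finite := by
  obtain ⟨N, hN⟩ := exists_nat_ge R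
  have hlen : ∀ l : List Cls, l.length =
      l.count .c1 + l.count .c2 + (l.count .c3 + l.count .c4) := by
    intro l
    induction l with
    | nil => rfl
    | cons i l ih => cases i <;> simp [ih] <;> omega
  refine ((List.finite_length_le Cls N).preimage Subtype.val_injective.injOn).subset ?_
  rintro (u : Buffer graph) hu
  have h1 : ((u.counts .c1 + u.counts .c2 + (u.counts .c3 + u.counts .c4) : ℕ) : ℝ) ≤ N := by
    push_cast
    exact le_trans hu hN
  have h2 := Nat.cast_le.1 h1
  exact (hlen u.1).le.trans h2

/-- The Foster–Lyapunov criterion for a drift that is negative for large buffers. -/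
theorem stable_of_drift (Φ : MatchingPolicy graph) {μ : Cls → ℝ} (hμ : μ ∈ posProb Cls)
    (f : ℝ → ℝ → ℝ → ℝ) (hf : ∀ u : Buffer graph, 0 ≤ u.val f) (ε L R : ℝ) (hε : 0 < ε)
    (hL : ∀ u : Buffer graph, ∑ v, μ v * (Φ.step u v).val f ≤ u.val f + L)
    (hdrift : ∀ u : Buffer graph, R < (u.counts .c1 : ℝ) + u.counts .c2 +
      (u.counts .c3 + u.counts .c4) → ∑ v, μ v * (Φ.step u v).val f ≤ u.val f - ε) :
    PositiveRecurrent (Φ.transition μ) :=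
  positiveRecurrent_of_drift (fun v => (hμ.1 v).le) hμ.2 (irreducible Φ hμ.1 hμ.2)
    (Buffer.val f) hf (finite_counts_le R) ε L hε hL fun u hu => hdrift u (not_le.1 hu)

/-- The function x + αy + n has drift 2b - 1 when class 2 is present. In the other nonempty states
it has drift a - bα or, when class 2 picks class 1 although y > 0, a - b. All three are negative. -/
theorem stable_of_lt_sq (Φ : MatchingPolicy graph) {μ : Cls → ℝ} (hμ : μ ∈ posProb Cls)
    (h34 : μ .c3 = μ .c4) (hab : μ .c1 < μ .c2) (hb : μ .c2 < 1 / 2)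
    (hsq : μ .c1 * (1 - μ .c1) < μ .c2 ^ 2) : PositiveRecurrent (Φ.transition μ) := by
  have hsum := hμ.2
  rw [sum_cls, h34] at hsum
  have h1 := hμ.1 .c1
  have h2 := hμ.1 .c2
  have h4 := hμ.1 .c4
  have hpos : 0 < 1 - μ .c1 := by linarith
  obtain ⟨α, hα⟩ : ∃ α, α = μ .c2 / (1 - μ .c1) := ⟨_, rfl⟩
  have hα0 : 0 ≤ α := hα ▸ div_nonneg h2.le hpos.le
  have e : μ .c1 < μ .c2 * α := by
    rw [hα, ← mul_div_assoc, lt_div_iff₀ hpos]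
    linarith
  have e' : α * (1 - μ .c1) = μ .c2 := hα ▸ div_mul_cancel₀ _ hpos.ne'
  obtain ⟨ε, hε, hε1, hε2, hε3⟩ : ∃ ε > 0, ε ≤ 1 - 2 * μ .c2 ∧ ε ≤ μ .c2 - μ .c1 ∧
      ε ≤ μ .c2 * α - μ .c1 :=
    ⟨min (1 - 2 * μ .c2) (min (μ .c2 - μ .c1) (μ .c2 * α - μ .c1)),
      lt_min (by linarith) (lt_min (by linarith) (by linarith)), min_le_left _ _,
      (min_le_right _ _).trans (min_le_left _ _), (min_le_right _ _).trans (min_le_right _ _)⟩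
  have e1 : 2 * μ .c4 * α = μ .c2 - μ .c2 * α := by
    have : 2 * μ .c4 = 1 - μ .c1 - μ .c2 := by linarith
    rw [this]
    linarith
  have e2 : μ .c1 = 1 - μ .c2 - 2 * μ .c4 := by linarith
  have key : ∀ u : Buffer graph, ((u.counts .c1 : ℝ) + u.counts .c2 +
        (u.counts .c3 + u.counts .c4) = 0 ∧
      ∑ v, μ v * (Φ.step u v).val (fun x n y => x + α * y + n) ≤
        u.val (fun x n y => x + α * y + n) + (1 + α)) ∨
      ∑ v, μ v * (Φ.step u v).val (fun x n y => x + α * y + n) ≤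
        u.val (fun x n y => x + α * y + n) - ε := by
    intro u
    obtain ⟨x, n, y, D, hx, hn, hy, hD, hc⟩ :=
      mean_step_cases Φ h34 (fun x n y => x + α * y + n) u
    rw [hD, Buffer.val_eq hx hn hy, hx, hn, hy]
    have h4α : 0 ≤ μ .c4 * α := mul_nonneg h4.le hα0
    have h2α : 0 ≤ μ .c2 * α := mul_nonneg h2.le hα0
    rw [e2] at hε2 hε3 hc
    rcases hc with ⟨rfl, rfl, rfl, rfl⟩ | hc
    · left
      constructor <;> linarith
    · right
      rcases hc with ⟨hc, rfl, rfl, rfl⟩ | ⟨hc, rfl, rfl, rfl⟩ |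
        ⟨hc, rfl, rfl, rfl⟩ | ⟨hx1, hy1, rfl, hs, rfl⟩ | ⟨hx1, hy1, rfl, -, rfl⟩ <;> linarith
  -- With radius 0, the empty buffer is the only exceptional state.
  refine stable_of_drift Φ hμ (fun x n y => x + α * y + n) (fun u => ?_) ε (1 + α) 0 hε
    (fun u => ?_) (fun u hu => ?_)
  · simp only [Buffer.val]
    positivity
  · rcases key u with h | h
    · exact h.2
    · linarith
  · rcases key u with h | h
    · exact absurd h.1 hu.ne'
    · exact h

/-- The total x + y drifts by a - b whenever y > 0, but may grow when y = 0 < x, as classes 3 and 4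
are then only stored. The term K x² compensates, since B makes x drift by a - b whenever x > 0. -/
theorem stable_of_policyB {B : MatchingPolicy graph} (hB : IsPolicyB B) {μ : Cls → ℝ}
    (hμ : μ ∈ posProb Cls) (h34 : μ .c3 = μ .c4) (hab : μ .c1 < μ .c2) (hb : μ .c2 < 1 / 2) :
    PositiveRecurrent (B.transition μ) := by
  have hsum := hμ.2
  rw [sum_cls, h34] at hsum
  have h1 := hμ.1 .c1
  have h2 := hμ.1 .c2
  have h4 := hμ.1 .c4
  -- This K makes K x² contribute -2x to first order, enough to pay for the 4cx ≤ 2x that arrivals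
  -- of classes 3 and 4 add to (x + y)² when y = 0.
  obtain ⟨K, hK0, hK⟩ : ∃ K, 0 ≤ K ∧ K * (μ .c2 - μ .c1) = 1 :=
    ⟨(μ .c2 - μ .c1)⁻¹, inv_nonneg.2 (by linarith), inv_mul_cancel₀ (by linarith)⟩
  obtain ⟨ε, hε, hε1, hε2⟩ : ∃ ε > 0, ε ≤ 1 - 2 * μ .c2 ∧ ε ≤ μ .c2 - μ .c1 :=
    ⟨min (1 - 2 * μ .c2) (μ .c2 - μ .c1), lt_min (by linarith) (by linarith), min_le_left _ _,
      min_le_right _ _⟩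
  have key : ∀ u : Buffer graph,
      ∑ v, μ v * (B.step u v).val (fun x n y => (x + y) ^ 2 + K * x ^ 2 + n ^ 2) ≤
        u.val (fun x n y => (x + y) ^ 2 + K * x ^ 2 + n ^ 2) -
          2 * ε * ((u.counts .c1 : ℝ) + u.counts .c2 + (u.counts .c3 + u.counts .c4)) +
          (1 + K) := by
    intro u
    obtain ⟨x, n, y, D, hx, hn, hy, hD, hc⟩ :=
      mean_step_cases B h34 (fun x n y => (x + y) ^ 2 + K * x ^ 2 + n ^ 2) u
    rw [hD, Buffer.val_eq hx hn hy, hx, hn, hy]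
    have k1 := mul_nonneg h1.le hK0
    have k2 := mul_nonneg h2.le hK0
    have k4 := mul_nonneg h4.le hK0
    have eK : K = μ .c1 * K + μ .c2 * K + 2 * (μ .c4 * K) := by
      linear_combination (-K) * hsum
    rcases hc with ⟨rfl, rfl, rfl, rfl⟩ | ⟨hc, rfl, rfl, rfl⟩ | ⟨hc, rfl, rfl, rfl⟩ |
      ⟨hc, rfl, rfl, rfl⟩ | ⟨hx1, hy1, rfl, hs, rfl⟩ | ⟨hx1, hy1, rfl, hs, rfl⟩
    · linarith
    · have := mul_nonneg (sub_nonneg.2 hε1) (zero_le_one.trans hc)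
      have e1 : μ .c1 = 1 - μ .c2 - 2 * μ .c4 := by linarith
      rw [e1]
      linarith
    · have := mul_nonneg (sub_nonneg.2 hε2) (zero_le_one.trans hc)
      have hx4 : 2 * μ .c4 * x ≤ x := mul_le_of_le_one_left (by linarith) (by linarith)
      have hKx : K * (μ .c2 - μ .c1) * x = x := by rw [hK, one_mul]
      have hsx : (μ .c1 + μ .c2 + (μ .c4 + μ .c4)) * ((1 + K) * x ^ 2) = (1 + K) * x ^ 2 := by
        rw [hsum, one_mul]
      linarith
    · have := mul_nonneg (sub_nonneg.2 hε2) (zero_le_one.trans hc)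
      have hsx : (μ .c1 + μ .c2 + (μ .c4 + μ .c4)) * y ^ 2 = y ^ 2 := by
        rw [hsum, one_mul]
      linarith
    · have := mul_nonneg (sub_nonneg.2 hε2) (by linarith : 0 ≤ x + y)
      have hKx : K * (μ .c2 - μ .c1) * x = x := by rw [hK, one_mul]
      have hsx : (μ .c1 + μ .c2 + (μ .c4 + μ .c4)) * ((x + y) ^ 2 + K * x ^ 2) =
          (x + y) ^ 2 + K * x ^ 2 := by
        rw [hsum, one_mul]
      linarith
    · have hx0 : (0 : ℝ) < u.counts .c1 := by linarith
      have := step_c2_of_policyB hB u (by exact_mod_cast hx0)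
      omega
  -- Beyond the radius (2 + K)/(2ε), the bound -2ε(x + n + y) + 1 + K falls below -1.
  refine stable_of_drift B hμ (fun x n y => (x + y) ^ 2 + K * x ^ 2 + n ^ 2) (fun u => ?_) 1
    (1 + K) ((2 + K) / (2 * ε)) one_pos (fun u => ?_) (fun u hu => ?_)
  · simp only [Buffer.val]
    positivity
  · have h := key u
    have : 0 ≤ 2 * ε * ((u.counts .c1 : ℝ) + u.counts .c2 + (u.counts .c3 + u.counts .c4)) := by
      positivity
    linarith
  · have h := key u
    rw [div_lt_iff₀ (by positivity)] at hu
    linarith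

end MatchingModel

theorem mainTheorem4 (A B : MatchingModel.MatchingPolicy MatchingModel.graph)
    (hA : MatchingModel.IsPolicyA A) (hB : MatchingModel.IsPolicyB B) :
    MatchingModel.Stab A =
      {μ | μ ∈ MatchingModel.posProb MatchingModel.Cls ∧ μ .c3 = μ .c4 ∧
        (μ .c1 < μ .c2 ∧ μ .c2 < 1 / 2) ∧ μ .c1 * (1 - μ .c1) < μ .c2 ^ 2} ∧
    MatchingModel.Stab B =
      {μ | μ ∈ MatchingModel.posProb MatchingModel.Cls ∧ μ .c3 = μ .c4 ∧
        (μ .c1 < μ .c2 ∧ μ .c2 < 1 / 2)} ∧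
    (∀ Φ : MatchingModel.MatchingPolicy MatchingModel.graph,
      MatchingModel.Stab A ⊆ MatchingModel.Stab Φ ∧
      MatchingModel.Stab Φ ⊆ MatchingModel.Stab B) := by
  open MatchingModel in
  have hN : ∀ Φ : MatchingPolicy graph, ∀ μ ∈ Stab Φ, μ .c1 < μ .c2 ∧ μ .c2 < 1 / 2 :=
    fun Φ μ ⟨⟨hμ, h⟩, h34⟩ => ⟨c1_lt_c2_of_stable Φ hμ h34 h, c2_lt_half_of_stable Φ hμ h34 h⟩
  refine ⟨Set.ext fun μ => ⟨fun h => ?_, fun h => ?_⟩, Set.ext fun μ => ⟨fun h => ?_, fun h => ?_⟩,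
    fun Φ => ⟨fun μ h => ?_, fun μ h => ?_⟩⟩
  · exact ⟨h.1.1, h.2, hN A μ h, lt_sq_of_policyA_stable hA h.1.1 h.2 h.1.2⟩
  · obtain ⟨hμ, h34, ⟨hab, hb⟩, hsq⟩ := h
    exact ⟨⟨hμ, stable_of_lt_sq A hμ h34 hab hb hsq⟩, h34⟩
  · exact ⟨h.1.1, h.2, hN B μ h⟩
  · obtain ⟨hμ, h34, hab, hb⟩ := h
    exact ⟨⟨hμ, stable_of_policyB hB hμ h34 hab hb⟩, h34⟩
  · obtain ⟨hab, hb⟩ := hN A μ h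
    exact ⟨⟨h.1.1, stable_of_lt_sq Φ h.1.1 h.2 hab hb
      (lt_sq_of_policyA_stable hA h.1.1 h.2 h.1.2)⟩, h.2⟩
  · obtain ⟨hab, hb⟩ := hN Φ μ h
    exact ⟨⟨h.1.1, stable_of_policyB hB h.1.1 h.2 hab hb⟩, h.2⟩
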